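/- All groups are finite and all characters are complex. For a subgroup $H\le K$ and $\theta\in\mathrm{Irr}(H)$, write $\mathrm{Irr}(K\mid\theta)$ for the set of irreducible characters of $K$ that lie over $\theta$, i.e. whose restriction to $H$ has $\theta$ as a constituent. A character is monomial if it is induced from a linear character of a subgroup, and a group is monomial if all its irreducible characters are. If $L\unlhd K$, $\lambda$ is a linear character of $L$ with stabilizer $K(\lambda)$ in $K$, and $\chi\in\mathrm{Irr}(K\mid\lambda)$, the $\lambda$-Clifford correspondent of $\chi$ is the unique character in $\mathrm{Irr}(K(\lambda)\mid\lambda)$ that induces $\chi$. Consider triples $T=(G,N,\psi)$ with $N\unlhd G$ and $\psi\in\mathrm{Irr}(N)$. If $L\unlhd G$, $L\le N$, and $\lambda$ is a linear character of $L$ lying under $\psi$, put $T(\lambda)=(G(\lambda),N(\lambda),\psi_\lambda)$, where $\psi_\lambda$ is the $\lambda$-Clifford correspondent of $\psi$; the triples $T(\lambda)$ are the direct linear reductions of $T$. A linear limit of $T$ is a triple $T'=(G',N',\psi')$ such that there is a finite chain $T=T_0,T_1,\dots,T_n=T'$ ($n\ge 0$) with each $T_i=T_{i-1}(\lambda_i)$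 a direct linear reduction of $T_{i-1}$, and such that $T'$ has no direct linear reduction other than $T'$ itself. For $\chi\in\mathrm{Irr}(G\mid\psi)$, a $T'$-reduction of $\chi$ is the last member $\chi'=\chi_n$ of a sequence $\chi=\chi_0,\chi_1,\dots,\chi_n$ in which, for some such chain, $\chi_i\in\mathrm{Irr}(G_i)$ is the $\lambda_i$-Clifford correspondent of $\chi_{i-1}$, where $T_i=(G_i,N_i,\psi_i)$. (a) Let $B$ be a normal subgroup of a finite group $G$, let $\gamma$ be a linear character of $B$, let $\chi\in\mathrm{Irr}(G\mid\gamma)$, and let $\chi_\gamma\in\mathrm{Irr}(G(\gamma))$ be the $\gamma$-Clifford correspondent of $\chi$. Then $\chi$ is monomial if and only if $\chi_\gamma$ is monomial. (b) Let $T'=(G',N',\psi')$ be a linear limit of $T=(G,N,\psi)$, and let $\chi'$ be the $T'$-reduction of $\chi\in\mathrm{Irr}(G\mid\psi)$. Then $\chi$ is monomial if and only if $\chi'$ is monomial. (c) Let $T'=(G',N',\psi')$ be a linear limit of $T=(G,N,\psi)$. If $G$ is a monomial group, then every character in $\mathrm{Irr}(G'\mid\psi')$ is monomial. -/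

import Mathlib

/-!
All groups are subgroups of one finite ambient group `Γ`, and characters are complex-valued
functions on (the elements of) these subgroups.
-/

noncomputable section

namespace LinearLimit

/-- `χ` is an irreducible complex character of the finite group `G`. Every finite-dimensional
representation is isomorphic to one on some `Fin n → ℂ`. -/
def IsIrrChar {G : Type*} [Group G] (χ : G → ℂ) : Prop :=
  ∃ (n : ℕ) (ρ : Representation ℂ G (Fin n → ℂ)), ρ.IsIrreducible ∧ ρ.character = χ

/-- The usual inner product `[α, β] = |G|⁻¹ ∑ α(x) conj(β(x))` of complex functions on a
finite group. -/
def charInner {G : Type*} [Group G] (α β : G → ℂ) : ℂ :=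
  (Nat.card G : ℂ)⁻¹ * ∑ᶠ x : G, α x * star (β x)

variable {Γ : Type*} [Group Γ]

/-- The linear character `H → ℂ` given by a homomorphism `H →* ℂˣ`. -/
def linChar {H : Subgroup Γ} (l : H →* ℂˣ) : H → ℂ := fun x => (l x : ℂ)

/-- For `H ≤ K`: the character `χ` of `K` lies over the irreducible character `θ` of `H`, i.e.
`θ` is a constituent of the restriction of `χ` to `H`. -/
def LiesOver {H K : Subgroup Γ} (χ : K → ℂ) (θ : H → ℂ) : Prop :=
  ∃ h : H ≤ K, charInner (fun x : H => χ (Subgroup.inclusion h x)) θ ≠ 0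

open Classical in
/-- The induced function `θ^K(g) = |H|⁻¹ ∑_{x ∈ K} θ°(x g x⁻¹)`, where `θ°` extends `θ` by zero
(only used for `H ≤ K`). -/
def induce {H K : Subgroup Γ} (θ : H → ℂ) : K → ℂ := fun g =>
  (Nat.card H : ℂ)⁻¹ *
    ∑ᶠ x : K, if hx : (x : Γ) * g * (x : Γ)⁻¹ ∈ H then θ ⟨(x : Γ) * g * (x : Γ)⁻¹, hx⟩ else 0

/-- A character of `K` is monomial if it is induced from a linear character of a subgroup. -/
def IsMonomial {K : Subgroup Γ} (χ : K → ℂ) : Prop :=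
  ∃ H : Subgroup Γ, H ≤ K ∧ ∃ l : H →* ℂˣ, induce (linChar l) = χ

/-- A monomial group: all irreducible characters are monomial. -/
def IsMonomialGroup (K : Subgroup Γ) : Prop :=
  ∀ χ : K → ℂ, IsIrrChar χ → IsMonomial χ

/-- The stabilizer `K(l)` in `K` of a linear character `l` of `L`: the elements `g` of `K` that
normalize `L` and satisfy `l (g x g⁻¹) = l x` for all `x ∈ L`. It is used for `L` normal in a
group that contains `K`, where the first requirement is void. -/
def stab (K : Subgroup Γ) {L : Subgroup Γ} (l : L →* ℂˣ) : Subgroup Γ where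
  carrier := {g | g ∈ K ∧ (∀ x, x ∈ L ↔ g * x * g⁻¹ ∈ L) ∧
    ∀ x (hx : x ∈ L) (hx' : g * x * g⁻¹ ∈ L), l ⟨g * x * g⁻¹, hx'⟩ = l ⟨x, hx⟩}
  one_mem' := ⟨K.one_mem, fun x => by simp, fun x hx hx' => by simp⟩
  mul_mem' := by
    rintro a b ⟨ha, ha1, ha2⟩ ⟨hb, hb1, hb2⟩
    have e : ∀ x, a * b * x * (a * b)⁻¹ = a * (b * x * b⁻¹) * a⁻¹ := fun x => by group
    refine ⟨K.mul_mem ha hb, fun x => ?_, fun x hx hx' => ?_⟩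
    · rw [e, ← ha1, ← hb1]
    · have h1 : b * x * b⁻¹ ∈ L := (hb1 x).1 hx
      have h2 : a * (b * x * b⁻¹) * a⁻¹ ∈ L := (ha1 _).1 h1
      rw [← hb2 x hx h1, ← ha2 _ h1 h2]
      congr 1
      exact Subtype.ext (e x)
  inv_mem' := by
    rintro a ⟨ha, ha1, ha2⟩
    have e : ∀ x, a * (a⁻¹ * x * a⁻¹⁻¹) * a⁻¹ = x := fun x => by group
    refine ⟨K.inv_mem ha, fun x => ?_, fun x hx hx' => ?_⟩
    · rw [ha1 (a⁻¹ * x * a⁻¹⁻¹), e]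
    · rw [← ha2 _ hx' (by rw [e]; exact hx)]
      congr 1
      exact Subtype.ext (e x)

/-- `χ'` is the Clifford correspondent of the irreducible character `χ` of `K` over the linear
character `l`: the irreducible character of the stabilizer `S = K(l)` that lies over `l` and
induces `χ`. -/
structure IsCliffordCorrespondent {K S L : Subgroup Γ} (l : L →* ℂˣ)
    (χ : K → ℂ) (χ' : S → ℂ) : Prop where
  eq_stab : S = stab K l
  irr : IsIrrChar χ'
  liesOver : LiesOver χ' (linChar l)
  induce_eq : induce χ' = χ

variable (Γ) in
/-- A triple `(G, N, ψ)` with `N` normal in `G` and `ψ ∈ Irr(N)`. -/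
structure Triple where
  G : Subgroup Γ
  N : Subgroup Γ
  le : N ≤ G
  normal : (N.subgroupOf G).Normal
  ψ : N → ℂ
  irr : IsIrrChar ψ

/-- `T'` is a subtriple of `T`. -/
def IsSubtriple (T T' : Triple Γ) : Prop :=
  T'.G ≤ T.G ∧ T'.N = T'.G ⊓ T.N ∧ LiesOver T.ψ T'.ψ

/-- `T'` is the subtriple `T(l)` of `T`, where `l` is a linear character, lying under `ψ`, of a
normal subgroup `L` of `G` contained in `N`. -/
structure IsDirectVia (T T' : Triple Γ) {L : Subgroup Γ} (l : L →* ℂˣ) : Prop where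
  le : L ≤ T.N
  normal : (L.subgroupOf T.G).Normal
  under : LiesOver T.ψ (linChar l)
  subtriple : IsSubtriple T T'
  G_eq : T'.G = stab T.G l
  clifford : IsCliffordCorrespondent l T.ψ T'.ψ

/-- `T'` is a direct linear reduction of `T`. -/
def IsDirectLinearReduction (T T' : Triple Γ) : Prop :=
  ∃ (L : Subgroup Γ) (l : L →* ℂˣ), IsDirectVia T T' l

/-- `T` has no direct linear reduction but itself. -/
def IsLinearlyIrreducible (T : Triple Γ) : Prop :=
  ∀ T' : Triple Γ, IsDirectLinearReduction T T' → T' = T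

/-- `T'` is reached from `T` by a finite chain (possibly of length zero) of direct linear
reductions. -/
def IsLinearReduction (T T' : Triple Γ) : Prop :=
  Relation.ReflTransGen IsDirectLinearReduction T T'

/-- `T'` is a linear limit of `T`. -/
def IsLinearLimit (T T' : Triple Γ) : Prop :=
  IsLinearReduction T T' ∧ IsLinearlyIrreducible T'

/-- `IsReduction χ T' χ'`: the character `χ'` of `G'` is the `T'`-reduction of the character `χ`
of `G`. There are a chain `T = T₀, T₁, …, Tₙ = T'` with `Tᵢ = Tᵢ₋₁(lᵢ)` and characters
`χ = χ₀, χ₁, …, χₙ = χ'` of the groups `Gᵢ` such that `χᵢ` is the `lᵢ`-Clifford correspondent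
of `χᵢ₋₁`. -/
inductive IsReduction {T : Triple Γ} (χ : T.G → ℂ) : (T' : Triple Γ) → (T'.G → ℂ) → Prop
  | refl : IsReduction χ T χ
  | step {T₁ T₂ : Triple Γ} {χ₁ : T₁.G → ℂ} {χ₂ : T₂.G → ℂ} {L : Subgroup Γ} (l : L →* ℂˣ) :
      IsReduction χ T₁ χ₁ → IsDirectVia T₁ T₂ l → IsCliffordCorrespondent l χ₁ χ₂ →
      IsReduction χ T₂ χ₂

end LinearLimit

end

open LinearLimit

/-! In (a), one direction is transitivity of induction. For the other, let `χ = λ^G` with `λ` linear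
on `H`. Since `χ` lies over `γ`, some conjugate of `(H, λ)` agrees with `γ` on `H ∩ B`; replace `(H,
λ)` by it. Put `K = HB` and let `I` be the stabilizer of `γ` in `K`. Then `I = (H ∩ I)B`, so `λ`
restricted to `H ∩ I` and `γ` have a common linear extension `μ` to `I` (`exists_common_extension`).
Now `μ^K` has norm 1 by Clifford theory, `λ^K` has norm at most that of `λ^G`, which is 1, and a
Mackey sum gives `[μ^K, λ^K] ≥ 1`. Hence `μ^K = λ^K` by `eq_of_charInner`, and `χ = μ^G`. As `I ≤
G(γ)`, inducing `μ` to `G(γ)` gives a character over `γ` that induces `χ`, which must be the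
Clifford correspondent.

The Clifford theory rests on `sum_induce_mul_star`: the `γ`-isotypic part of an induced function,
read on the stabilizer, is the original function. So induction from the stabilizer is isometric and
injective on `γ`-homogeneous class functions.

Part (b) iterates (a) along the chain. For (c), an irreducible character over `ψ'` is induced back
up the chain; every stage gives an irreducible character over the previous `ψ`, with the given one
as its Clifford correspondent. At the top it is monomial, and (a) carries this back down. -/

noncomputable section
namespace LinearLimit
open Representation
open scoped MonoidAlgebra ComplexOrder

/-! ### Irreducible characters: orthonormality, Schur's lemma, constituents of induced
representations -/

section Characters
variable {G : Type*} [Group G]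

lemma charInner_eq_sum [Fintype G] (α β : G → ℂ) :
    charInner α β = (Nat.card G : ℂ)⁻¹ * ∑ x, α x * star (β x) := by
  rw [charInner, finsum_eq_sum_of_fintype]

lemma IsIrrChar.conj {χ : G → ℂ} (h : IsIrrChar χ) (x g : G) : χ (x * g * x⁻¹) = χ g := by
  obtain ⟨n, ρ, -, rfl⟩ := h
  exact ρ.char_conj g x

/-- Averaging gives an invariant Hermitian form `P`, positive definite because the summand at 1 is
the identity. Invariance makes `M g⁻¹` conjugate under `P` to the adjoint of `M g`, so the traces
agree. -/
lemma character_inv_eq_star [Finite G] {n : ℕ} (ρ : Representation ℂ G (Fin n → ℂ)) (g : G) :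
    ρ.character g⁻¹ = star (ρ.character g) := by
  classical
  have := Fintype.ofFinite G
  let M : G → Matrix (Fin n) (Fin n) ℂ := fun g => LinearMap.toMatrix' (ρ g)
  have hM : ∀ a b, M (a * b) = M a * M b := fun a b => by
    simp only [M, map_mul, LinearMap.toMatrix'_mul]
  have hM1 : M 1 = 1 := by simp [M]
  have htr : ∀ a, ρ.character a = (M a).trace := fun a => by
    rw [Representation.character, LinearMap.trace_eq_matrix_trace ℂ (Pi.basisFun ℂ (Fin n))]
    rfl
  let P : Matrix (Fin n) (Fin n) ℂ := ∑ x : G, (M x).conjTranspose * M x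
  have hP : P.PosDef := by
    have h1 : P = (M 1).conjTranspose * M 1 +
        ∑ x ∈ Finset.univ.erase (1 : G), (M x).conjTranspose * M x :=
      (Finset.add_sum_erase _ _ (Finset.mem_univ _)).symm
    rw [h1, hM1, Matrix.conjTranspose_one, one_mul]
    exact Matrix.PosDef.one.add_posSemidef
      (Matrix.posSemidef_sum _ fun x _ => Matrix.posSemidef_conjTranspose_mul_self _)
  have hinv : (M g).conjTranspose * P * M g = P := by
    simp only [P, Finset.mul_sum, Finset.sum_mul]
    refine Fintype.sum_equiv (Equiv.mulRight g) _ _ fun x => ?_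
    simp only [Equiv.coe_mulRight, hM, Matrix.conjTranspose_mul, mul_assoc]
  have hu : IsUnit P.det := (Matrix.isUnit_iff_isUnit_det _).1 hP.isUnit
  have hg : M g * M g⁻¹ = 1 := by rw [← hM, mul_inv_cancel, hM1]
  have h2 : (M g).conjTranspose * P = P * M g⁻¹ := by
    rw [← hinv, mul_assoc _ (M g), hg, mul_one, hinv]
  have h3 : M g⁻¹ = P⁻¹ * ((M g).conjTranspose * P) := by
    rw [h2, ← mul_assoc, Matrix.nonsing_inv_mul _ hu, one_mul]
  rw [htr, htr, h3, Matrix.trace_mul_comm, mul_assoc, Matrix.mul_nonsing_inv _ hu, mul_one,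
    Matrix.trace_conjTranspose]

lemma charInner_character_eq_finrank [Finite G] {m n : ℕ} (ρ : Representation ℂ G (Fin m → ℂ))
    (σ : Representation ℂ G (Fin n → ℂ)) :
    charInner ρ.character σ.character = Module.finrank ℂ (IntertwiningMap σ ρ) := by
  have := Fintype.ofFinite G
  have : Invertible (Nat.card G : ℂ) := invertibleOfNonzero (by simp)
  rw [charInner_eq_sum, ← card_inv_mul_sum_char_mul_char_eq_finrank]
  simp only [character_inv_eq_star]

lemma IsIrrChar.charInner_self [Finite G] {χ : G → ℂ} (h : IsIrrChar χ) : charInner χ χ = 1 := by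
  obtain ⟨n, ρ, hρ, rfl⟩ := h
  rw [charInner_character_eq_finrank, IsIrreducible.finrank_intertwiningMap_self, Nat.cast_one]

lemma IsIrrChar.apply_one_ne_zero [Finite G] {χ : G → ℂ} (h : IsIrrChar χ) : χ 1 ≠ 0 := by
  intro h0
  have h1 := h.charInner_self
  obtain ⟨n, ρ, hρ, rfl⟩ := h
  rw [char_one, Module.finrank_fin_fun, Nat.cast_eq_zero] at h0
  subst h0
  have : Subsingleton (IntertwiningMap ρ ρ) :=
    ⟨fun f g => IntertwiningMap.ext (Subsingleton.elim _ _)⟩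
  rw [charInner_character_eq_finrank, Module.finrank_zero_of_subsingleton] at h1
  simp at h1

/-- An invariant linear character `l` of a normal subgroup `L` either accounts for the whole
restriction to `L` of an irreducible character `χ`, or the `l`-isotypic part of `χ` vanishes. -/
lemma IsIrrChar.homogeneous_or [Finite G] {χ : G → ℂ} (h : IsIrrChar χ) {L : Type*} [Group L]
    [Fintype L] (i : L →* G) (l : L →* ℂˣ) (c : G → L ≃ L)
    (hc : ∀ s b, i (c s b) = s * i b * s⁻¹) (hl : ∀ s b, l (c s b) = l b) :
    (∀ s b, χ (s * i b) = χ s * l b) ∨ ∀ s, ∑ b, χ (s * i b) * (l b⁻¹ : ℂˣ) = 0 := by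
  obtain ⟨n, ρ, hρ, rfl⟩ := h
  -- Up to the factor `|L|`, `e` is the projection onto the `l`-isotypic subspace. Invariance of `l`
  -- makes it commute with `ρ`, so by Schur's lemma it is a scalar `a`; the two alternatives are `a
  -- ≠ 0` and `a = 0`.
  let e : (Fin n → ℂ) →ₗ[ℂ] (Fin n → ℂ) := ∑ b, ((l b⁻¹ : ℂˣ) : ℂ) • ρ (i b)
  have hcomm : ∀ s, e * ρ s = ρ s * e := fun s => by
    simp only [e, Finset.sum_mul, Finset.mul_sum]
    refine (Fintype.sum_equiv (c s) _ _ fun b => ?_).symm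
    have : i (c s b) * s = s * i b := by rw [hc]; group
    rw [mul_smul_comm, smul_mul_assoc, ← map_mul, ← map_mul, this, map_inv, map_inv, hl]
  have hmul : ∀ b, ρ (i b) * e = ((l b : ℂˣ) : ℂ) • e := fun b => by
    simp only [e, Finset.mul_sum, Finset.smul_sum]
    refine Fintype.sum_equiv (Equiv.mulLeft b) _ _ fun b' => ?_
    simp only [Equiv.coe_mulLeft, map_mul, mul_inv_rev, map_inv, Units.val_mul, smul_smul,
      mul_smul_comm]
    congr 1
    rw [mul_comm, mul_assoc, ← Units.val_mul, inv_mul_cancel, Units.val_one, mul_one]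
  obtain ⟨a, ha⟩ := (IsIrreducible.algebraMap_intertwiningMap_bijective_of_isAlgClosed
    (ρ := ρ)).2 ⟨e, hcomm⟩
  have hea : e = a • (1 : (Fin n → ℂ) →ₗ[ℂ] (Fin n → ℂ)) := by
    exact (congrArg IntertwiningMap.toLinearMap ha).symm
  by_cases h0 : a = 0
  · right
    intro s
    have : ∑ b, ρ.character (s * i b) * (l b⁻¹ : ℂˣ) = LinearMap.trace ℂ _ (ρ s * e) := by
      simp only [e, Finset.mul_sum, map_sum, mul_smul_comm, map_smul, ← map_mul, smul_eq_mul,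
        Representation.character, mul_comm]
    rw [this, hea, h0, zero_smul, mul_zero, map_zero]
  · left
    intro s b
    have : ρ (i b) = ((l b : ℂˣ) : ℂ) • 1 := by
      have := hmul b
      rw [hea, mul_smul_comm, mul_one, smul_comm] at this
      exact smul_right_injective _ h0 this
    rw [Representation.character, map_mul, this, mul_smul_comm, mul_one, map_smul, smul_eq_mul,
      mul_comm]
    rfl

lemma isIrreducible_of_equiv {V W : Type*} [AddCommGroup V] [Module ℂ V] [AddCommGroup W]
    [Module ℂ W] {ρ : Representation ℂ G V} {σ : Representation ℂ G W} (φ : ρ.Equiv σ)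
    (h : ρ.IsIrreducible) : σ.IsIrreducible := by
  rw [irreducible_iff_isSimpleModule_asModule] at h ⊢
  have e : ρ.asModule ≃ₗ[ℂ[G]] σ.asModule :=
    LinearEquiv.ofBijective (IntertwiningMap.equivLinearMapAsModule ρ σ φ.toIntertwiningMap)
      φ.toLinearEquiv.bijective
  exact IsSimpleModule.congr e.symm

lemma isIrreducible_ofModule' (M : Type*) [AddCommGroup M] [Module ℂ M] [Module ℂ[G] M]
    [IsScalarTower ℂ ℂ[G] M] [IsSimpleModule ℂ[G] M] :
    (ofModule' M : Representation ℂ G M).IsIrreducible := by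
  rw [irreducible_iff_isSimpleModule_asModule]
  let e : (ofModule' M : Representation ℂ G M).asModule ≃ₗ[ℂ[G]] M :=
    { (asModuleEquiv _).toAddEquiv with
      map_smul' := fun r x => by
        change asModuleEquiv _ (r • x) = r • asModuleEquiv _ x
        have h : asAlgebraHom (ofModule' M : Representation ℂ G M) = Algebra.lsmul ℂ ℂ M :=
          (MonoidAlgebra.lift ℂ (M →ₗ[ℂ] M) G).apply_symm_apply _
        rw [asModuleEquiv_map_smul, h]
        rfl }
  exact IsSimpleModule.congr e

/-- Every irreducible character of a subgroup lies under an irreducible character of the group. -/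
lemma IsIrrChar.exists_charInner_ne_zero [Finite G] {S : Type*} [Group S] (i : S →* G)
    (hi : Function.Injective i) {θ : S → ℂ} (h : IsIrrChar θ) :
    ∃ χ : G → ℂ, IsIrrChar χ ∧ ∃ m : ℕ, m ≠ 0 ∧ charInner (fun s => χ (i s)) θ = m := by
  classical
  have := Fintype.ofFinite G
  have : Finite S := Finite.of_injective i hi
  have := Fintype.ofFinite S
  obtain ⟨n, ρ, hρ, rfl⟩ := h
  obtain ⟨w, hw⟩ : ∃ w : Fin n → ℂ, w ≠ 0 := by
    by_contra! hn
    have : (⊥ : Subrepresentation ρ) ≠ ⊤ := bot_ne_top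
    exact this (SetLike.ext fun x => by
      rw [hn x]; exact ⟨fun _ => Submodule.zero_mem _, fun _ => Submodule.zero_mem _⟩)
  obtain ⟨j, hj⟩ := Function.ne_iff.1 hw
  -- An `S`-equivariant map into the group algebra of `G`, built from the `j`-th coordinate of the
  -- orbit; `j` is chosen so that `w j ≠ 0`, which keeps `J w` from vanishing.
  let J : (Fin n → ℂ) →ₗ[ℂ] ℂ[G] :=
    ∑ s : S, MonoidAlgebra.lsingle (i s) ∘ₗ LinearMap.proj j ∘ₗ ρ s⁻¹
  have hJ : ∀ x, J x = ∑ s : S, MonoidAlgebra.single (i s) (ρ s⁻¹ x j) := fun x => by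
    simp [J]
  have hJmul : ∀ (t : S) x, J (ρ t x) = MonoidAlgebra.single (i t) 1 * J x := fun t x => by
    rw [hJ, hJ, Finset.mul_sum]
    refine (Fintype.sum_equiv (Equiv.mulLeft t) _ _ fun s => ?_).symm
    simp [MonoidAlgebra.single_mul_single]
  have hJw : J w ≠ 0 := fun h0 => hj <| by
    have h1 : (J w).coeff (i 1) = w j := by
      rw [hJ, MonoidAlgebra.coeff_sum, Finsupp.finsetSum_apply, Finset.sum_eq_single 1]
      · simp
      · intro s _ hs
        rw [MonoidAlgebra.coeff_single, Finsupp.single_eq_of_ne]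
        exact fun h => hs (hi h.symm)
      · simp
    rw [← h1, h0]; rfl
  have : NeZero (Nat.card G : ℂ) := ⟨by simp⟩
  -- By Maschke the Jacobson radical is zero, so some maximal left ideal misses `J w`. The quotient
  -- by it is simple and receives a nonzero `S`-map from `ρ`.
  obtain ⟨N, hN, hwN⟩ : ∃ N : Submodule ℂ[G] ℂ[G], IsCoatom N ∧ J w ∉ N := by
    by_contra! hn
    have h1 : J w ∈ Module.jacobson ℂ[G] ℂ[G] := Submodule.mem_sInf.2 fun N hN => hn N hN
    rw [IsSemisimpleModule.jacobson_eq_bot] at h1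
    exact hJw h1
  have hsimple : IsSimpleModule ℂ[G] (ℂ[G] ⧸ N) := isSimpleModule_iff_isCoatom.2 hN
  have : Module.Finite ℂ ℂ[G] := inferInstance
  let V := ℂ[G] ⧸ N
  let τ : Representation ℂ G V := ofModule' V
  have hτ : τ.IsIrreducible := isIrreducible_ofModule' V
  let q : ℂ[G] →ₗ[ℂ] V := N.mkQ.restrictScalars ℂ
  have hq : Function.Surjective q := N.mkQ_surjective
  have hqmul : ∀ g x, q (MonoidAlgebra.single g 1 * x) = τ g (q x) := fun g x => by
    exact N.mkQ.map_smul (MonoidAlgebra.single g (1 : ℂ)) x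
  have : Module.Finite ℂ V := Module.Finite.of_surjective q hq
  let e : V ≃ₗ[ℂ] (Fin (Module.finrank ℂ V) → ℂ) := (Module.finBasis ℂ V).equivFun
  let σ : Representation ℂ G (Fin (Module.finrank ℂ V) → ℂ) :=
    (e.conjRingEquiv : Module.End ℂ V →* _).comp τ
  have hσ : ∀ g x, σ g (e x) = e (τ g x) := fun g x => by
    simp [σ, LinearEquiv.conjRingEquiv]
  let φ : τ.Equiv σ := Representation.Equiv.mk e fun g =>
    LinearMap.ext fun x => (hσ g x).symm
  refine ⟨σ.character, ⟨_, σ, isIrreducible_of_equiv φ hτ, rfl⟩,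
    Module.finrank ℂ (IntertwiningMap ρ (σ.comp i)), fun h0 => ?_,
    charInner_character_eq_finrank (σ.comp i) ρ⟩
  let F : IntertwiningMap ρ (σ.comp i) := ⟨e.toLinearMap ∘ₗ q ∘ₗ J, fun t => LinearMap.ext fun x => by
    simp only [LinearMap.comp_apply, hJmul, hqmul, MonoidHom.comp_apply, LinearEquiv.coe_coe, hσ]⟩
  have h1 := Module.finrank_zero_iff.1 h0
  have h2 : e (q (J w)) = 0 := congrArg (fun F : IntertwiningMap ρ (σ.comp i) => F w)
    (Subsingleton.elim F 0)
  rw [LinearEquiv.map_eq_zero_iff] at h2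
  exact hwN ((Submodule.Quotient.mk_eq_zero N).1 h2)

end Characters
end LinearLimit
end

noncomputable section
namespace LinearLimit
open scoped Classical

/-! ### Induced class functions, Frobenius reciprocity, orthogonality of linear characters -/

section Induction
variable {Γ : Type*} [Group Γ]

/-- Extension by zero of a function on a subgroup to the ambient group. -/
def extendZero {H : Subgroup Γ} (θ : H → ℂ) (g : Γ) : ℂ := if h : g ∈ H then θ ⟨g, h⟩ else 0

lemma extendZero_of_mem {H : Subgroup Γ} (θ : H → ℂ) {g : Γ} (h : g ∈ H) :
    extendZero θ g = θ ⟨g, h⟩ := dif_pos h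

lemma extendZero_of_notMem {H : Subgroup Γ} (θ : H → ℂ) {g : Γ} (h : g ∉ H) :
    extendZero θ g = 0 := dif_neg h

@[simp] lemma extendZero_coe {H : Subgroup Γ} (θ : H → ℂ) (h : H) : extendZero θ h = θ h :=
  extendZero_of_mem θ h.2

lemma conj_mem_iff {H : Subgroup Γ} {x g : Γ} (hx : x ∈ H) : x * g * x⁻¹ ∈ H ↔ g ∈ H := by
  rw [H.mul_mem_cancel_right (H.inv_mem hx), H.mul_mem_cancel_left hx]

lemma extendZero_conj {H : Subgroup Γ} {θ : H → ℂ} (hθ : ∀ x g : H, θ (x * g * x⁻¹) = θ g)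
    {x : Γ} (hx : x ∈ H) (g : Γ) : extendZero θ (x * g * x⁻¹) = extendZero θ g := by
  by_cases hg : g ∈ H
  · rw [extendZero_of_mem θ hg, extendZero_of_mem θ ((conj_mem_iff hx).2 hg)]
    exact hθ ⟨x, hx⟩ ⟨g, hg⟩
  · rw [extendZero_of_notMem θ hg, extendZero_of_notMem θ (mt (conj_mem_iff hx).1 hg)]

lemma linChar_conj {H : Subgroup Γ} (l : H →* ℂˣ) (x g : H) :
    linChar l (x * g * x⁻¹) = linChar l g := by
  simp [linChar]

variable [Fintype Γ]

lemma card_subgroup_ne_zero (H : Subgroup Γ) : (Nat.card H : ℂ) ≠ 0 :=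
  Nat.cast_ne_zero.2 Nat.card_pos.ne'

lemma sum_subgroup_eq {H K : Subgroup Γ} (h : H ≤ K) (F : Γ → ℂ) (hF : ∀ g ∉ H, F g = 0) :
    ∑ x : H, F x = ∑ x : K, F x := by
  have key : ∀ M : Subgroup Γ, H ≤ M → ∑ x : M, F x = ∑ x : Γ, F x := fun M hM => by
    rw [← Finset.sum_subtype (Finset.univ.filter (· ∈ M)) (by simp) F]
    exact Finset.sum_subset (Finset.subset_univ _) fun x _ hx =>
      hF x fun hxH => hx (by simpa using hM hxH)
  rw [key H le_rfl, key K h]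

lemma induce_apply {H K : Subgroup Γ} (θ : H → ℂ) (g : K) :
    (induce θ : K → ℂ) g = (Nat.card H : ℂ)⁻¹ * ∑ x : K, extendZero θ (x * g * (x : Γ)⁻¹) := by
  rw [induce, finsum_eq_sum_of_fintype]
  rfl

lemma induce_conj {H K : Subgroup Γ} (θ : H → ℂ) (y g : K) :
    (induce θ : K → ℂ) (y * g * y⁻¹) = induce θ g := by
  rw [induce_apply, induce_apply]
  congr 1
  refine Fintype.sum_equiv (Equiv.mulRight y) _ _ fun x => ?_
  simp [mul_assoc]

lemma extendZero_induce {H K : Subgroup Γ} (h : H ≤ K) (θ : H → ℂ) (g : Γ) :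
    extendZero (induce θ : K → ℂ) g =
      (Nat.card H : ℂ)⁻¹ * ∑ x : K, extendZero θ (x * g * (x : Γ)⁻¹) := by
  by_cases hg : g ∈ K
  · rw [extendZero_of_mem _ hg, induce_apply]
  · rw [extendZero_of_notMem _ hg, Finset.sum_eq_zero, mul_zero]
    exact fun x _ => extendZero_of_notMem _ fun hx => hg ((conj_mem_iff x.2).1 (h hx))

lemma induce_induce {H S K : Subgroup Γ} (hHS : H ≤ S) (hSK : S ≤ K) (θ : H → ℂ) :
    (induce (induce θ : S → ℂ) : K → ℂ) = induce θ := by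
  ext g
  rw [induce_apply, induce_apply]
  simp only [extendZero_induce hHS, ← Finset.mul_sum]
  rw [Finset.sum_comm]
  have : ∀ s : S, ∑ x : K, extendZero θ (s * (x * g * (x : Γ)⁻¹) * (s : Γ)⁻¹) =
      ∑ x : K, extendZero θ (x * g * (x : Γ)⁻¹) := fun s => by
    refine Fintype.sum_equiv (Equiv.mulLeft (⟨s, hSK s.2⟩ : K)) _ _ fun x => ?_
    simp [mul_assoc]
  rw [Finset.sum_congr rfl fun s _ => this s, Finset.sum_const, Finset.card_univ,
    ← Nat.card_eq_fintype_card, nsmul_eq_mul]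
  have := card_subgroup_ne_zero S
  field_simp

lemma charInner_star {G : Type*} [Group G] [Finite G] (α β : G → ℂ) :
    star (charInner α β) = charInner β α := by
  have := Fintype.ofFinite G
  simp [charInner_eq_sum, mul_comm]

/-- Frobenius reciprocity for class functions. -/
lemma charInner_induce_left {H K : Subgroup Γ} (h : H ≤ K) (θ : H → ℂ) {β : K → ℂ}
    (hβ : ∀ x g : K, β (x * g * x⁻¹) = β g) :
    charInner (induce θ) β = charInner θ (fun x => β (Subgroup.inclusion h x)) := by
  rw [charInner_eq_sum, charInner_eq_sum]
  have h1 : ∀ g : K, (induce θ : K → ℂ) g * star (β g) = (Nat.card H : ℂ)⁻¹ *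
      ∑ x : K, extendZero θ (x * g * (x : Γ)⁻¹) * star (β (x * g * x⁻¹)) := fun g => by
    simp only [hβ, induce_apply, ← Finset.sum_mul]
    rw [mul_assoc]
  have h2 : ∀ x : K, ∑ g : K, extendZero θ (x * g * (x : Γ)⁻¹) * star (β (x * g * x⁻¹)) =
      ∑ g : K, extendZero θ g * star (β g) := fun x =>
    Fintype.sum_equiv (MulAut.conj x).toEquiv _ _ fun g => by simp
  have h3 : ∑ g : K, extendZero θ g * star (β g) =
      ∑ x : H, θ x * star (β (Subgroup.inclusion h x)) := by
    have := sum_subgroup_eq h (fun g => extendZero θ g * star (extendZero β g))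
      fun g hg => by rw [extendZero_of_notMem θ hg, zero_mul]
    simp only [extendZero_coe] at this
    rw [← this]
    refine Finset.sum_congr rfl fun x _ => ?_
    rw [extendZero_of_mem β (h x.2)]
    rfl
  simp only [h1, ← Finset.mul_sum]
  rw [Finset.sum_comm, Finset.sum_congr rfl fun x _ => h2 x, Finset.sum_const, Finset.card_univ,
    ← Nat.card_eq_fintype_card, nsmul_eq_mul, h3]
  have := card_subgroup_ne_zero K
  field_simp

lemma charInner_induce_right {H K : Subgroup Γ} (h : H ≤ K) (θ : H → ℂ) {β : K → ℂ}
    (hβ : ∀ x g : K, β (x * g * x⁻¹) = β g) :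
    charInner β (induce θ) = charInner (fun x => β (Subgroup.inclusion h x)) θ := by
  rw [← charInner_star, charInner_induce_left h θ hβ, charInner_star]

/-- The squared norm of `α - β` is at most `1 + 1 - 2 = 0`. This identifies characters without
decomposing them into irreducibles. -/
lemma eq_of_charInner {G : Type*} [Group G] [Finite G] {α β : G → ℂ} (hα : (charInner α α).re ≤ 1)
    (hβ : (charInner β β).re ≤ 1) (hαβ : 1 ≤ (charInner α β).re) : α = β := by
  have := Fintype.ofFinite G
  have hc : (0 : ℝ) < Nat.card G := Nat.cast_pos.2 Nat.card_pos
  have key : ((Nat.card G : ℝ)⁻¹ * ∑ x, ‖α x - β x‖ ^ 2 : ℝ) =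
      (charInner α α).re + (charInner β β).re - 2 * (charInner α β).re := by
    have h1 : (((Nat.card G : ℝ)⁻¹ * ∑ x, ‖α x - β x‖ ^ 2 : ℝ) : ℂ) =
        charInner α α + charInner β β - charInner α β - star (charInner α β) := by
      rw [charInner_star]
      simp only [charInner_eq_sum, ← mul_add, ← mul_sub, ← Finset.sum_add_distrib,
        ← Finset.sum_sub_distrib]
      push_cast
      congr 1
      refine Finset.sum_congr rfl fun x _ => ?_
      rw [← Complex.mul_conj', ← starRingEnd_apply, ← starRingEnd_apply, map_sub]
      ring
    have := congrArg Complex.re h1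
    rw [Complex.ofReal_re] at this
    rw [this]
    simp
    ring
  have h0 : ∑ x, ‖α x - β x‖ ^ 2 ≤ 0 := by
    have : (Nat.card G : ℝ)⁻¹ * ∑ x, ‖α x - β x‖ ^ 2 ≤ 0 := by linarith
    exact nonpos_of_mul_nonpos_right this (inv_pos.2 hc)
  ext x
  have hx := Finset.single_le_sum (f := fun x => ‖α x - β x‖ ^ 2) (fun _ _ => by positivity)
    (Finset.mem_univ x)
  have : ‖α x - β x‖ = 0 := by
    have := le_antisymm (hx.trans h0) (by positivity)
    simpa using this
  exact sub_eq_zero.1 (norm_eq_zero.1 this)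

lemma star_linear_character {L : Type*} [Group L] [Finite L] (l : L →* ℂˣ) (b : L) :
    star (l b : ℂ) = (l b⁻¹ : ℂˣ) := by
  have h1 : IsOfFinOrder (l b : ℂ) :=
    MonoidHom.isOfFinOrder ((Units.coeHom ℂ).comp l) (isOfFinOrder_of_finite b)
  rw [map_inv, Units.val_inv_eq_inv_val, Complex.inv_eq_conj h1.norm_eq_one]
  rfl

lemma sum_linear_mul_star {L : Type*} [Group L] [Fintype L] (l m : L →* ℂˣ) :
    ∑ b, (l b : ℂ) * star (m b : ℂ) = if l = m then (Nat.card L : ℂ) else 0 := by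
  have h1 : ∀ b, (l b : ℂ) * star (m b : ℂ) = ((Units.coeHom ℂ).comp (l * m⁻¹)) b := fun b => by
    simp [star_linear_character]
  rw [Finset.sum_congr rfl fun b _ => h1 b]
  split_ifs with h
  · subst h
    have h2 : ∀ b, ((Units.coeHom ℂ).comp (l * l⁻¹)) b = 1 := fun b => by simp
    simp only [h2, Finset.sum_const, Finset.card_univ, Nat.card_eq_fintype_card, nsmul_eq_mul,
      mul_one]
  · refine sum_hom_units_eq_zero _ fun h2 => h ?_
    ext b
    have := DFunLike.congr_fun h2 b
    simp only [MonoidHom.comp_apply, MonoidHom.mul_apply, MonoidHom.inv_apply, Units.coeHom_apply,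
      MonoidHom.one_apply, Units.val_eq_one, mul_inv_eq_one] at this
    rw [this]

end Induction

/-! ### Homogeneous functions and Clifford theory over a linear character -/

section Stabilizer
variable {Γ : Type*} [Group Γ]

lemma conj_mem_of_normal {L K : Subgroup Γ} (hLK : L ≤ K) (hn : (L.subgroupOf K).Normal) {x b : Γ}
    (hx : x ∈ K) (hb : b ∈ L) : x * b * x⁻¹ ∈ L :=
  hn.conj_mem ⟨b, hLK hb⟩ hb ⟨x, hx⟩

lemma stab_le (K : Subgroup Γ) {L : Subgroup Γ} (l : L →* ℂˣ) : stab K l ≤ K := fun _ h => h.1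

lemma mem_stab_iff {L K : Subgroup Γ} (hLK : L ≤ K) (hn : (L.subgroupOf K).Normal) (l : L →* ℂˣ)
    {x : Γ} : x ∈ stab K l ↔ ∃ hx : x ∈ K,
      ∀ b : L, l ⟨x * b * x⁻¹, conj_mem_of_normal hLK hn hx b.2⟩ = l b := by
  refine ⟨fun h => ⟨h.1, fun b => h.2.2 b b.2 _⟩, fun ⟨hx, h⟩ => ⟨hx, fun b => ⟨fun hb =>
    conj_mem_of_normal hLK hn hx hb, fun hb => ?_⟩, fun b hb _ => h ⟨b, hb⟩⟩⟩
  have := conj_mem_of_normal hLK hn (K.inv_mem hx) hb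
  simpa [mul_assoc] using this

lemma le_stab {L K : Subgroup Γ} (hLK : L ≤ K) (hn : (L.subgroupOf K).Normal) (l : L →* ℂˣ) :
    L ≤ stab K l := fun x hx =>
  (mem_stab_iff hLK hn l).2 ⟨hLK hx, fun b => Units.ext (linChar_conj l ⟨x, hx⟩ b)⟩

/-- The function `θ` on a subgroup transforms under right translation by `L` through the linear
character `l`. -/
def Homogeneous {L S : Subgroup Γ} (l : L →* ℂˣ) (θ : S → ℂ) : Prop :=
  ∀ (g : Γ) (b : L), extendZero θ (g * b) = extendZero θ g * l b

lemma homogeneous_of_forall {L S : Subgroup Γ} (h : L ≤ S) (l : L →* ℂˣ) {θ : S → ℂ}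
    (hθ : ∀ (s : S) (b : L), θ (s * Subgroup.inclusion h b) = θ s * l b) : Homogeneous l θ := by
  intro g b
  by_cases hg : g ∈ S
  · rw [extendZero_of_mem θ hg, extendZero_of_mem θ (S.mul_mem hg (h b.2))]
    exact hθ ⟨g, hg⟩ b
  · rw [extendZero_of_notMem θ hg, extendZero_of_notMem θ, zero_mul]
    rwa [S.mul_mem_cancel_right (h b.2)]

lemma homogeneous_linChar {L H : Subgroup Γ} (h : L ≤ H) {l : L →* ℂˣ} (m : H →* ℂˣ)
    (hm : ∀ b : L, m (Subgroup.inclusion h b) = l b) : Homogeneous l (linChar m) :=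
  homogeneous_of_forall h l fun s b => by simp [linChar, hm]

variable [Fintype Γ]

/-- Restriction to the `l`-isotypic part inverts induction from the stabilizer of `l`. -/
lemma sum_induce_mul_star {L K S : Subgroup Γ} (hLK : L ≤ K) (hn : (L.subgroupOf K).Normal)
    (l : L →* ℂˣ) (hS : S = stab K l) {θ : S → ℂ} (hcl : ∀ x g : S, θ (x * g * x⁻¹) = θ g)
    (hθ : Homogeneous l θ) (s : S) :
    ∑ b : L, extendZero (induce θ : K → ℂ) (s * b) * star (l b : ℂ) = Nat.card L * θ s := by
  have hSK : S ≤ K := hS ▸ stab_le K l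
  let c : K → L →* L := fun x => MonoidHom.mk'
    (fun b => ⟨x * b * (x : Γ)⁻¹, conj_mem_of_normal hLK hn x.2 b.2⟩)
    fun a b => Subtype.ext (by simp [mul_assoc])
  have hc : ∀ x : K, l.comp (c x) = l ↔ (x : Γ) ∈ S := fun x => by
    rw [hS, mem_stab_iff hLK hn l]
    exact ⟨fun h => ⟨x.2, fun b => DFunLike.congr_fun h b⟩,
      fun ⟨_, h⟩ => MonoidHom.ext fun b => h b⟩
  have h1 : ∀ (b : L) (x : K), extendZero θ (x * (s * b) * (x : Γ)⁻¹) * star (l b : ℂ) =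
      extendZero θ (x * s * (x : Γ)⁻¹) * (l.comp (c x) b * star (l b : ℂ)) := fun b x => by
    have : (x * (s * b) * (x : Γ)⁻¹ : Γ) = x * s * (x : Γ)⁻¹ * (c x b : L) := by
      simp [c, mul_assoc]
    rw [this, hθ, mul_assoc]
    rfl
  simp only [extendZero_induce hSK, mul_assoc (Nat.card S : ℂ)⁻¹, Finset.sum_mul]
  rw [← Finset.mul_sum, Finset.sum_comm]
  -- Conjugation by `x` turns `l` into `l.comp (c x)`; by orthogonality only those `x` that fix `l`
  -- contribute.
  have h2 : ∀ x : K, ∑ b : L, extendZero θ (x * (s * b) * (x : Γ)⁻¹) * star (l b : ℂ) =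
      if (x : Γ) ∈ S then θ s * Nat.card L else 0 := fun x => by
    rw [Finset.sum_congr rfl fun b _ => h1 b x, ← Finset.mul_sum, sum_linear_mul_star]
    simp only [hc]
    split_ifs with hx
    · rw [extendZero_conj hcl hx, extendZero_coe]
    · rw [mul_zero]
  rw [Finset.sum_congr rfl fun x _ => h2 x,
    ← sum_subgroup_eq hSK (fun x => if x ∈ S then θ s * Nat.card L else 0)
      fun g hg => if_neg hg]
  simp only [SetLike.coe_mem, if_true, Finset.sum_const, Finset.card_univ,
    ← Nat.card_eq_fintype_card, nsmul_eq_mul]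
  have := card_subgroup_ne_zero S
  field_simp

/-- Translating the summation variable by `L` and averaging shows that pairing with a homogeneous
`ψ` sees only the `l`-isotypic part of `α`. -/
lemma sum_mul_star_homogeneous {L M : Subgroup Γ} (h : L ≤ M) {l : L →* ℂˣ} {ψ : M → ℂ}
    (hψ : Homogeneous l ψ) (α : Γ → ℂ) :
    Nat.card L * ∑ m : M, α m * star (ψ m) =
      ∑ m : M, (∑ b : L, α (m * b) * star (l b : ℂ)) * star (ψ m) := by
  simp only [Finset.sum_mul]
  rw [Finset.sum_comm]
  have : ∀ b : L, ∑ m : M, α (m * b) * star (l b : ℂ) * star (ψ m) =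
      ∑ m : M, α m * star (ψ m) := fun b => by
    refine Fintype.sum_equiv (Equiv.mulRight (⟨b, h b.2⟩ : M)) _ _ fun m => ?_
    have := hψ m b
    rw [extendZero_of_mem ψ (M.mul_mem m.2 (h b.2)), extendZero_coe] at this
    have h' : ψ (m * ⟨b, h b.2⟩) = ψ m * l b := this
    simp only [Equiv.coe_mulRight, h', star_mul]
    simp [mul_assoc]
  rw [Finset.sum_congr rfl fun b _ => this b]
  simp

lemma charInner_restrict_induce {L K S M : Subgroup Γ} (hLK : L ≤ K)
    (hn : (L.subgroupOf K).Normal) (l : L →* ℂˣ) (hS : S = stab K l) {θ : S → ℂ}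
    (hcl : ∀ x g : S, θ (x * g * x⁻¹) = θ g) (hθ : Homogeneous l θ) (hLM : L ≤ M) (hMS : M ≤ S)
    (hMK : M ≤ K) {ψ : M → ℂ} (hψ : Homogeneous l ψ) :
    charInner (fun m => (induce θ : K → ℂ) (Subgroup.inclusion hMK m)) ψ =
      charInner (fun m => θ (Subgroup.inclusion hMS m)) ψ := by
  have h1 := sum_mul_star_homogeneous hLM hψ (extendZero (induce θ : K → ℂ))
  have h2 : ∀ m : M, ∑ b : L, extendZero (induce θ : K → ℂ) (m * b) * star (l b : ℂ) =
      Nat.card L * θ (Subgroup.inclusion hMS m) := fun m =>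
    sum_induce_mul_star hLK hn l hS hcl hθ (Subgroup.inclusion hMS m)
  simp only [h2, mul_assoc, ← Finset.mul_sum] at h1
  have h3 := mul_left_cancel₀ (card_subgroup_ne_zero L) h1
  rw [charInner_eq_sum, charInner_eq_sum, ← h3]
  congr 1
  refine Finset.sum_congr rfl fun m _ => ?_
  rw [extendZero_of_mem _ (hMK m.2)]
  rfl

/-- Frobenius reciprocity, followed by the restriction formula with `M = S` and `ψ = θ`. -/
lemma charInner_induce_self {L K S : Subgroup Γ} (hLK : L ≤ K)
    (hn : (L.subgroupOf K).Normal) (l : L →* ℂˣ) (hS : S = stab K l) {θ : S → ℂ}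
    (hcl : ∀ x g : S, θ (x * g * x⁻¹) = θ g) (hθ : Homogeneous l θ) :
    charInner (induce θ : K → ℂ) (induce θ) = charInner θ θ := by
  have hSK : S ≤ K := hS ▸ stab_le K l
  rw [charInner_induce_right hSK θ (induce_conj θ)]
  exact charInner_restrict_induce hLK hn l hS hcl hθ (hS ▸ le_stab hLK hn l) le_rfl hSK hθ

lemma IsIrrChar.homogeneous_or_sum_eq_zero {L K S : Subgroup Γ} (hLK : L ≤ K)
    (hn : (L.subgroupOf K).Normal) (l : L →* ℂˣ) (hS : S = stab K l) {χ : S → ℂ}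
    (h : IsIrrChar χ) : Homogeneous l χ ∨
      ∀ s : S, ∑ b : L, extendZero χ (s * b) * star (l b : ℂ) = 0 := by
  have hLS : L ≤ S := hS ▸ le_stab hLK hn l
  have hSK : S ≤ K := hS ▸ stab_le K l
  have hmem : ∀ s : S, ∀ b : L, (s * b * (s : Γ)⁻¹ : Γ) ∈ L := fun s b =>
    conj_mem_of_normal hLK hn (hSK s.2) b.2
  have hmem' : ∀ s : S, ∀ b : L, ((s : Γ)⁻¹ * b * (s : Γ) : Γ) ∈ L := fun s b => by
    simpa using hmem s⁻¹ b
  let c : S → L ≃ L := fun s =>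
    { toFun := fun b => ⟨s * b * (s : Γ)⁻¹, hmem s b⟩
      invFun := fun b => ⟨(s : Γ)⁻¹ * b * s, hmem' s b⟩
      left_inv := fun b => Subtype.ext (by simp [mul_assoc])
      right_inv := fun b => Subtype.ext (by simp [mul_assoc]) }
  rcases h.homogeneous_or (Subgroup.inclusion hLS) l c (fun s b => rfl) (fun s b =>
      ((mem_stab_iff hLK hn l).1 (hS ▸ s.2)).2 b) with h1 | h1
  · exact Or.inl (homogeneous_of_forall hLS l h1)
  · refine Or.inr fun s => ?_
    rw [← h1 s]
    refine Finset.sum_congr rfl fun b _ => ?_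
    rw [extendZero_of_mem χ (S.mul_mem s.2 (hLS b.2)), star_linear_character]
    rfl

/-- In the other alternative of the dichotomy, `χ` would be orthogonal to `ψ`. The intermediate
group `M` allows both `M = L` and, for triples, `M = N'`. -/
lemma IsIrrChar.homogeneous_of_liesOver {L K S M : Subgroup Γ} (hLK : L ≤ K)
    (hn : (L.subgroupOf K).Normal) {l : L →* ℂˣ} (hS : S = stab K l) {χ : S → ℂ}
    (h : IsIrrChar χ) (hLM : L ≤ M) {ψ : M → ℂ} (hψ : Homogeneous l ψ) (hχψ : LiesOver χ ψ) :
    Homogeneous l χ := by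
  refine (h.homogeneous_or_sum_eq_zero hLK hn l hS).resolve_right fun h0 => ?_
  obtain ⟨hMS, hne⟩ := hχψ
  refine hne ?_
  have h1 := sum_mul_star_homogeneous hLM hψ (extendZero χ)
  have h2 : ∀ m : M, ∑ b : L, extendZero χ (m * b) * star (l b : ℂ) = 0 :=
    fun m => h0 (Subgroup.inclusion hMS m)
  simp only [h2, zero_mul, Finset.sum_const_zero, mul_eq_zero, card_subgroup_ne_zero,
    false_or] at h1
  rw [charInner_eq_sum, ← mul_zero (Nat.card M : ℂ)⁻¹, ← h1]
  congr 1
  refine Finset.sum_congr rfl fun m _ => ?_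
  rw [extendZero_of_mem χ (hMS m.2)]
  rfl

end Stabilizer
end LinearLimit
end

noncomputable section
namespace LinearLimit
open scoped Classical ComplexOrder

/-! ### Monomial characters and their Clifford correspondents -/

section Monomial
variable {Γ : Type*} [Group Γ]

/-- A linear character of `H` and an agreeing invariant linear character of a subgroup `B`
normalized by `H` have a common extension to `I`, if every element of `I` is a product of an
element of `H` stabilizing the second one and an element of `B`. -/
lemma exists_common_extension {H B I : Subgroup Γ} (lam : H →* ℂˣ) (γ : B →* ℂˣ)
    (hagree : ∀ b (hb : b ∈ B) (hH : b ∈ H), lam ⟨b, hH⟩ = γ ⟨b, hb⟩)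
    (hconj : ∀ h ∈ H, h ∈ I → ∀ b (hb : b ∈ B), ∃ hb' : h * b * h⁻¹ ∈ B,
      γ ⟨h * b * h⁻¹, hb'⟩ = γ ⟨b, hb⟩) (hBI : B ≤ I)
    (hI : ∀ g ∈ I, ∃ h ∈ H, ∃ b ∈ B, h * b = g) :
    ∃ mu : I →* ℂˣ, (∀ b (hb : b ∈ B), mu ⟨b, hBI hb⟩ = γ ⟨b, hb⟩) ∧
      ∀ h (hH : h ∈ H) (hI : h ∈ I), mu ⟨h, hI⟩ = lam ⟨h, hH⟩ := by
  choose! p hp q hq hpq using hI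
  have well : ∀ h (hh : h ∈ H) b (hb : b ∈ B) h' (hh' : h' ∈ H) b' (hb' : b' ∈ B),
      h * b = h' * b' → lam ⟨h, hh⟩ * γ ⟨b, hb⟩ = lam ⟨h', hh'⟩ * γ ⟨b', hb'⟩ := by
    intro h hh b hb h' hh' b' hb' e
    have e1 : h'⁻¹ * h = b' * b⁻¹ := by
      rw [eq_mul_inv_iff_mul_eq, mul_assoc, e, inv_mul_cancel_left]
    have h1 := hagree (h'⁻¹ * h) (e1 ▸ B.mul_mem hb' (B.inv_mem hb))
      (H.mul_mem (H.inv_mem hh') hh)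
    have h2 : (⟨h'⁻¹ * h, H.mul_mem (H.inv_mem hh') hh⟩ : H) = ⟨h', hh'⟩⁻¹ * ⟨h, hh⟩ := rfl
    have h3 : (⟨h'⁻¹ * h, e1 ▸ B.mul_mem hb' (B.inv_mem hb)⟩ : B) = ⟨b', hb'⟩ * ⟨b, hb⟩⁻¹ :=
      Subtype.ext e1
    rw [h2, h3, map_mul, map_mul, map_inv, map_inv, eq_mul_inv_iff_mul_eq, mul_assoc,
      inv_mul_eq_iff_eq_mul] at h1
    exact h1
  -- The extension must send `h * b` to `lam h * γ b`; agreement on `H ⊓ B` makes this independent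
  -- of the factorization.
  let f : I → ℂˣ := fun g => lam ⟨p g, hp g g.2⟩ * γ ⟨q g, hq g g.2⟩
  have hf : ∀ (g : I) h (hh : h ∈ H) b (hb : b ∈ B), h * b = g →
      f g = lam ⟨h, hh⟩ * γ ⟨b, hb⟩ := fun g h hh b hb e =>
    well _ _ _ _ _ _ _ _ ((hpq g g.2).trans e.symm)
  refine ⟨MonoidHom.mk' f fun g g' => ?_, fun b hb => ?_, fun h hH hI => ?_⟩
  · have hpI : p g' ∈ I := by
      have := hpq g' g'.2
      rw [← eq_mul_inv_iff_mul_eq] at this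
      rw [this]
      exact I.mul_mem g'.2 (I.inv_mem (hBI (hq g' g'.2)))
    obtain ⟨hm, hγ⟩ := hconj (p g')⁻¹ (H.inv_mem (hp g' g'.2)) (I.inv_mem hpI) (q g) (hq g g.2)
    -- Refactor `(hb)(h'b')` as `hh'` times `(h'⁻¹bh')b'`; since `h'` lies in `I`, this conjugation
    -- does not change `γ b`.
    rw [hf (g * g') (p g * p g') (H.mul_mem (hp g g.2) (hp g' g'.2))
      ((p g')⁻¹ * q g * (p g')⁻¹⁻¹ * q g') (B.mul_mem hm (hq g' g'.2))]
    · have h2 : (⟨p g * p g', H.mul_mem (hp g g.2) (hp g' g'.2)⟩ : H) =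
        ⟨p g, hp g g.2⟩ * ⟨p g', hp g' g'.2⟩ := rfl
      have h3 : (⟨(p g')⁻¹ * q g * (p g')⁻¹⁻¹ * q g', B.mul_mem hm (hq g' g'.2)⟩ : B) =
        ⟨(p g')⁻¹ * q g * (p g')⁻¹⁻¹, hm⟩ * ⟨q g', hq g' g'.2⟩ := rfl
      rw [h2, h3, map_mul, map_mul, hγ, mul_mul_mul_comm]
    · calc p g * p g' * ((p g')⁻¹ * q g * (p g')⁻¹⁻¹ * q g')
          = (p g * q g) * (p g' * q g') := by group
        _ = g * g' := by rw [hpq g g.2, hpq g' g'.2]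
  · have := hf ⟨b, hBI hb⟩ 1 H.one_mem b hb (one_mul b)
    refine this.trans ?_
    have h1 : lam ⟨1, H.one_mem⟩ = 1 := map_one lam
    rw [h1, one_mul]
  · have := hf ⟨h, hI⟩ h hH 1 B.one_mem (mul_one h)
    refine this.trans ?_
    have h1 : γ ⟨1, B.one_mem⟩ = 1 := map_one γ
    rw [h1, mul_one]

variable [Fintype Γ]

lemma sum_extendZero_linChar_mul_star {H M : Subgroup Γ} (lam : H →* ℂˣ) (mu : M →* ℂˣ) :
    ∑ h : H, extendZero (linChar mu) h * star (lam h : ℂ) =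
      if mu.comp (Subgroup.inclusion (inf_le_right : H ⊓ M ≤ M)) =
        lam.comp (Subgroup.inclusion (inf_le_left : H ⊓ M ≤ H)) then
        (Nat.card (H ⊓ M : Subgroup Γ) : ℂ) else 0 := by
  have h1 := sum_subgroup_eq (inf_le_left : H ⊓ M ≤ H)
    (fun g => extendZero (linChar mu) g * star (extendZero (linChar lam) g)) fun g hg => by
      rcases not_and_or.1 hg with h | h
      · simp [extendZero_of_notMem _ h]
      · simp [extendZero_of_notMem _ h]
  simp only [extendZero_coe] at h1
  refine h1.symm.trans ?_
  rw [← sum_linear_mul_star]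
  refine Finset.sum_congr rfl fun g _ => ?_
  rw [extendZero_of_mem _ g.2.2, extendZero_of_mem _ g.2.1]
  rfl

lemma exists_conj_linChar {H K : Subgroup Γ} (hHK : H ≤ K) (lam : H →* ℂˣ) {x : Γ} (hx : x ∈ K) :
    ∃ (H' : Subgroup Γ) (lam' : H' →* ℂˣ), H' ≤ K ∧
      (∀ g, extendZero (linChar lam') g = extendZero (linChar lam) (x * g * x⁻¹)) ∧
      (induce (linChar lam') : K → ℂ) = induce (linChar lam) := by
  let H' : Subgroup Γ := H.comap (MulAut.conj x).toMonoidHom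
  let e : H' →* H := ((MulAut.conj x).toMonoidHom.comp H'.subtype).codRestrict H fun h => h.2
  have hext : ∀ g, extendZero (linChar (lam.comp e)) g =
      extendZero (linChar lam) (x * g * x⁻¹) := fun g => by
    by_cases hg : x * g * x⁻¹ ∈ H
    · rw [extendZero_of_mem _ hg, extendZero_of_mem _ (show g ∈ H' from hg)]
      rfl
    · rw [extendZero_of_notMem _ hg, extendZero_of_notMem _ (show g ∉ H' from hg)]
  refine ⟨H', lam.comp e, fun g hg => (conj_mem_iff hx).1 (hHK hg), hext, ?_⟩
  have hcard : Nat.card H' = Nat.card H :=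
    Nat.card_congr ((MulAut.conj x).toEquiv.subtypeEquiv fun g => Iff.rfl)
  ext g
  rw [induce_apply, induce_apply, hcard]
  congr 1
  refine Fintype.sum_equiv (Equiv.mulLeft (⟨x, hx⟩ : K)) _ _ fun y => ?_
  rw [hext]
  simp [mul_assoc]

lemma charInner_induce_linChar {H M K : Subgroup Γ} (hHK : H ≤ K)
    (lam : H →* ℂˣ) (mu : M →* ℂˣ) :
    charInner (induce (linChar mu) : K → ℂ) (induce (linChar lam)) =
      (Nat.card H : ℂ)⁻¹ * (Nat.card M : ℂ)⁻¹ *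
        ∑ x : K, ∑ h : H, extendZero (linChar mu) (x * h * (x : Γ)⁻¹) * star (lam h : ℂ) := by
  rw [charInner_induce_right hHK _ (induce_conj _), charInner_eq_sum, mul_assoc, Finset.sum_comm]
  congr 1
  rw [Finset.mul_sum]
  refine Finset.sum_congr rfl fun h _ => ?_
  rw [induce_apply, mul_assoc, Finset.sum_mul]
  rfl

/-- After conjugating the pair `(H, lam)`, orthogonality on the intersection makes the sum either a
group order or 0. -/
lemma sum_conj_linChar_nonneg {H : Subgroup Γ} (lam : H →* ℂˣ) (x : Γ) :
    0 ≤ ∑ h : H, extendZero (linChar lam) (x * h * x⁻¹) * star (lam h : ℂ) := by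
  obtain ⟨H', lam', -, hext, -⟩ := exists_conj_linChar le_top lam (Subgroup.mem_top x)
  simp only [← hext]
  rw [sum_extendZero_linChar_mul_star]
  split_ifs
  · exact Nat.cast_nonneg _
  · exact le_rfl

/-- Both norms are the same Mackey sum with nonnegative terms, taken over `K` and over the larger
`G`. -/
lemma charInner_induce_linChar_mono {H K G : Subgroup Γ} (hHK : H ≤ K) (hKG : K ≤ G)
    (lam : H →* ℂˣ) :
    charInner (induce (linChar lam) : K → ℂ) (induce (linChar lam)) ≤
      charInner (induce (linChar lam) : G → ℂ) (induce (linChar lam)) := by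
  rw [charInner_induce_linChar hHK, charInner_induce_linChar (hHK.trans hKG)]
  let A : Γ → ℂ := fun x => ∑ h : H, extendZero (linChar lam) (x * h * x⁻¹) * star (lam h : ℂ)
  refine mul_le_mul_of_nonneg_left (?_ : ∑ x : K, A x ≤ ∑ x : G, A x) (by positivity)
  have h1 := sum_subgroup_eq hKG (fun x => if x ∈ K then A x else 0) fun g hg => if_neg hg
  simp only [SetLike.coe_mem, if_true] at h1
  rw [h1]
  refine Finset.sum_le_sum fun x _ => ?_
  split_ifs
  · exact le_rfl
  · exact sum_conj_linChar_nonneg lam x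

lemma card_mul_card_le_card_mul_card_inf {H I K : Subgroup Γ} (hH : H ≤ K) (hI : I ≤ K) :
    Nat.card H * Nat.card I ≤ Nat.card K * Nat.card (H ⊓ I : Subgroup Γ) := by
  have h1 := Subgroup.relIndex_mul_relIndex ⊥ H K bot_le hH
  have h2 := Subgroup.relIndex_mul_relIndex ⊥ (H ⊓ I) I bot_le inf_le_right
  rw [Subgroup.inf_relIndex_right] at h2
  simp only [Subgroup.relIndex_bot_left] at h1 h2
  have h3 : H.relIndex I ≤ H.relIndex K :=
    Subgroup.relIndex_le_of_le_right hI fun h0 => by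
      rw [h0, mul_zero] at h1
      exact Nat.card_pos.ne h1
  calc Nat.card H * Nat.card I = Nat.card H * Nat.card (H ⊓ I : Subgroup Γ) * H.relIndex I := by
        rw [← h2, mul_assoc]
    _ ≤ Nat.card H * Nat.card (H ⊓ I : Subgroup Γ) * H.relIndex K := Nat.mul_le_mul_left _ h3
    _ = Nat.card K * Nat.card (H ⊓ I : Subgroup Γ) := by rw [← h1]; ring

/-- If the character induced from the linear character `lam` of `H` is irreducible and `lam` agrees
with a linear character `γ` of a normal subgroup `B` on `H ⊓ B`, then it is also induced
from an extension of `γ` to a subgroup of the stabilizer of `γ`. -/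
lemma exists_linear_extension_induce_eq {H B G : Subgroup Γ} (hHG : H ≤ G) (hBG : B ≤ G)
    (hn : (B.subgroupOf G).Normal) (lam : H →* ℂˣ) (γ : B →* ℂˣ)
    (hagree : ∀ b (hb : b ∈ B) (hH : b ∈ H), lam ⟨b, hH⟩ = γ ⟨b, hb⟩)
    (hirr : charInner (induce (linChar lam) : G → ℂ) (induce (linChar lam)) = 1) :
    ∃ (I : Subgroup Γ) (mu : I →* ℂˣ), I ≤ stab G γ ∧ ∃ hBI : B ≤ I,
      (∀ b : B, mu (Subgroup.inclusion hBI b) = γ b) ∧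
      (induce (linChar mu) : G → ℂ) = induce (linChar lam) := by
  let K : Subgroup Γ := H ⊔ B
  have hHK : H ≤ K := le_sup_left
  have hBK : B ≤ K := le_sup_right
  have hKG : K ≤ G := sup_le hHG hBG
  have hK : ∀ g ∈ K, ∃ h ∈ H, ∃ b ∈ B, h * b = g := fun g hg => by
    have hnorm : H ≤ Subgroup.normalizer (B : Set Γ) :=
      hHG.trans ((Subgroup.normal_subgroupOf_iff_le_normalizer hBG).1 hn)
    have : g ∈ (↑(H ⊔ B) : Set Γ) := hg
    rw [Subgroup.coe_mul_of_left_le_normalizer_right H B hnorm] at this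
    exact Set.mem_mul.1 this
  have hnK : (B.subgroupOf K).Normal := ⟨fun b hb x =>
    conj_mem_of_normal hBG hn (hKG x.2) (show (b : Γ) ∈ B from hb)⟩
  let I := stab K γ
  have hIK : I ≤ K := stab_le K γ
  have hBI : B ≤ I := le_stab hBK hnK γ
  have hIG : I ≤ stab G γ := fun x hx => ⟨hKG hx.1, hx.2⟩
  obtain ⟨mu, hmuB, hmuH⟩ := exists_common_extension (I := I) lam γ hagree
    (fun h _ hI b hb => ⟨conj_mem_of_normal hBK hnK hI.1 hb, hI.2.2 b hb _⟩) hBI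
    fun g hg => hK g (hIK hg)
  refine ⟨I, mu, hIG, hBI, fun b => hmuB b b.2, ?_⟩
  have hhom : Homogeneous γ (linChar mu) := homogeneous_linChar hBI mu fun b => hmuB b b.2
  have key : (induce (linChar mu) : K → ℂ) = induce (linChar lam) := by
    refine eq_of_charInner ?_ ?_ ?_
    · rw [charInner_induce_self hBK hnK γ rfl (linChar_conj mu) hhom, charInner_eq_sum]
      have := sum_linear_mul_star mu mu
      rw [if_pos rfl] at this
      refine le_of_eq ?_
      change ((Nat.card I : ℂ)⁻¹ * ∑ x, (mu x : ℂ) * star (mu x : ℂ)).re = 1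
      rw [this, inv_mul_cancel₀ (card_subgroup_ne_zero I), Complex.one_re]
    · have := charInner_induce_linChar_mono hHK hKG lam
      rw [hirr] at this
      exact (Complex.le_def.1 this).1
    · rw [charInner_induce_linChar hHK]
      -- Every `x` contributes equally: writing `x = h₀b = (h₀bh₀⁻¹)h₀`, the first factor lies in
      -- `I` and is absorbed by `mu`, while `h₀` is absorbed by reindexing over `H`.
      have h1 : ∀ x : K, ∑ h : H, extendZero (linChar mu) (x * h * (x : Γ)⁻¹) * star (lam h : ℂ) =
          Nat.card (H ⊓ I : Subgroup Γ) := fun x => by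
        obtain ⟨h₀, hh₀, b, hb, hx⟩ := hK x x.2
        have hb' : h₀ * b * h₀⁻¹ ∈ I := hBI (conj_mem_of_normal hBK hnK (hHK hh₀) hb)
        have h2 : ∀ h : H, extendZero (linChar mu) (x * h * (x : Γ)⁻¹) =
            extendZero (linChar mu) (h₀ * h * h₀⁻¹) := fun h => by
          rw [← extendZero_conj (linChar_conj mu) hb' (h₀ * h * h₀⁻¹), ← hx]
          congr 1
          group
        have h3 : ∑ h : H, extendZero (linChar mu) (x * h * (x : Γ)⁻¹) * star (lam h : ℂ) =
            ∑ h : H, extendZero (linChar mu) h * star (lam h : ℂ) := by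
          refine Fintype.sum_equiv (MulAut.conj (⟨h₀, hh₀⟩ : H)).toEquiv _ _ fun h => ?_
          rw [h2]
          have h4 := linChar_conj lam ⟨h₀, hh₀⟩ h
          simp only [linChar] at h4
          simp [← h4]
        rw [h3, sum_extendZero_linChar_mul_star, if_pos]
        exact MonoidHom.ext fun g => hmuH g g.2.1 g.2.2
      rw [Finset.sum_congr rfl fun x _ => h1 x, Finset.sum_const, Finset.card_univ,
        ← Nat.card_eq_fintype_card, nsmul_eq_mul]
      -- The inner product is `|K||H ∩ I| / (|H||I|)`, at least 1 because the set `HI` lies in `K`.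
      have h5 := card_mul_card_le_card_mul_card_inf hHK hIK
      have h6 : ((Nat.card H : ℂ)⁻¹ * (Nat.card I : ℂ)⁻¹ *
          (Nat.card K * Nat.card (H ⊓ I : Subgroup Γ))) =
          (((Nat.card K * Nat.card (H ⊓ I : Subgroup Γ) : ℝ) / (Nat.card H * Nat.card I) : ℝ) :
            ℂ) := by
        push_cast
        rw [div_eq_mul_inv, mul_inv, mul_comm]
      rw [h6, Complex.ofReal_re, one_le_div (by
        have : 0 < Nat.card H := Nat.card_pos
        have : 0 < Nat.card I := Nat.card_pos
        positivity)]
      exact_mod_cast h5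
  rw [← induce_induce hIK hKG, key, induce_induce hHK hKG]

lemma homogeneous_induce {L I K S : Subgroup Γ} (hLK : L ≤ K) (hn : (L.subgroupOf K).Normal)
    {l : L →* ℂˣ} (hS : S = stab K l) (hIS : I ≤ S) {θ : I → ℂ} (hθ : Homogeneous l θ) :
    Homogeneous l (induce θ : S → ℂ) := by
  intro g b
  rw [extendZero_induce hIS, extendZero_induce hIS, mul_assoc, Finset.sum_mul]
  congr 1
  refine Finset.sum_congr rfl fun x _ => ?_
  obtain ⟨hx, hl⟩ := (mem_stab_iff hLK hn l).1 (hS.le x.2)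
  rw [← hl b, ← hθ]
  congr 1
  simp [mul_assoc]

/-- Both functions are recovered as the `l`-isotypic part of the common induced function. -/
lemma eq_of_induce_eq {L K S : Subgroup Γ} (hLK : L ≤ K) (hn : (L.subgroupOf K).Normal)
    {l : L →* ℂˣ} (hS : S = stab K l) {θ θ' : S → ℂ} (hcl : ∀ x g : S, θ (x * g * x⁻¹) = θ g)
    (hcl' : ∀ x g : S, θ' (x * g * x⁻¹) = θ' g) (hθ : Homogeneous l θ) (hθ' : Homogeneous l θ')
    (h : (induce θ : K → ℂ) = induce θ') : θ = θ' := by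
  ext s
  have h1 := sum_induce_mul_star hLK hn l hS hcl hθ s
  rw [h, sum_induce_mul_star hLK hn l hS hcl' hθ' s] at h1
  exact (mul_left_cancel₀ (card_subgroup_ne_zero L) h1).symm

lemma IsMonomial.induce {S K : Subgroup Γ} (hSK : S ≤ K) {θ : S → ℂ} (h : IsMonomial θ) :
    IsMonomial (induce θ : K → ℂ) := by
  obtain ⟨H, hHS, lam, rfl⟩ := h
  exact ⟨H, hHS.trans hSK, lam, (induce_induce hHS hSK _).symm⟩

/-- An irreducible character is monomial if and only if its Clifford correspondent over a linear
character of a normal subgroup is. -/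
theorem IsCliffordCorrespondent.isMonomial_iff {L K S : Subgroup Γ} (hLK : L ≤ K)
    (hn : (L.subgroupOf K).Normal) {l : L →* ℂˣ} {χ : K → ℂ} {χ' : S → ℂ} (hχ : IsIrrChar χ)
    (hc : IsCliffordCorrespondent l χ χ') : IsMonomial χ ↔ IsMonomial χ' := by
  have hS := hc.eq_stab
  have hSK : S ≤ K := hS ▸ stab_le K l
  refine ⟨?_, fun h => hc.induce_eq ▸ h.induce hSK⟩
  rintro ⟨H, hHK, lam, hlam⟩
  have hLS : L ≤ S := hS ▸ le_stab hLK hn l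
  have hhom : Homogeneous l χ' := hc.irr.homogeneous_of_liesOver hLK hn hS le_rfl
    (homogeneous_linChar le_rfl l fun b => rfl) hc.liesOver
  have hover : charInner (fun b => χ (Subgroup.inclusion hLK b)) (linChar l) ≠ 0 := by
    have := charInner_restrict_induce hLK hn l hS hc.irr.conj hhom le_rfl hLS hLK
      (homogeneous_linChar le_rfl l fun b => rfl)
    rw [hc.induce_eq] at this
    rw [this]
    exact hc.liesOver.2
  -- The multiplicity of `l` in the restriction of `χ` is a sum over the conjugates of `lam`, so
  -- some conjugate pairs nontrivially with `l`; orthogonality then forces agreement on the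
  -- intersection with `L`.
  obtain ⟨x, hx⟩ : ∃ x : K, ∑ b : L, extendZero (linChar lam) (x * b * (x : Γ)⁻¹) *
      star (l b : ℂ) ≠ 0 := by
    by_contra! h0
    refine hover ?_
    rw [charInner_eq_sum, ← hlam]
    simp only [induce_apply, mul_assoc (Nat.card H : ℂ)⁻¹, Finset.sum_mul, ← Finset.mul_sum]
    rw [Finset.sum_comm, Finset.sum_eq_zero, mul_zero, mul_zero]
    exact fun x _ => h0 x
  obtain ⟨H', lam', hH'K, hext, hind⟩ := exists_conj_linChar hHK lam x.2
  simp only [← hext] at hx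
  rw [sum_extendZero_linChar_mul_star] at hx
  have hagree := (ite_ne_right_iff.1 hx).1
  obtain ⟨I, mu, hIS, hLI, hmu, hmuind⟩ := exists_linear_extension_induce_eq hH'K hLK hn lam' l
    (fun b hb hH => DFunLike.congr_fun hagree ⟨b, hb, hH⟩)
    (by rw [hind, hlam]; exact hχ.charInner_self)
  have hIS' : I ≤ S := hS ▸ hIS
  refine ⟨I, hIS', mu, ?_⟩
  refine eq_of_induce_eq hLK hn hS (induce_conj _) hc.irr.conj
    (homogeneous_induce hLK hn hS hIS' (homogeneous_linChar hLI mu hmu)) hhom ?_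
  rw [induce_induce hIS' hSK, hmuind, hind, hlam, hc.induce_eq]

end Monomial

/-! ### Passing along chains of direct linear reductions -/

section Limits
variable {Γ : Type*} [Group Γ] [Fintype Γ]

/-- Clifford correspondence: induction from the stabilizer of a linear character `l` of a normal
subgroup preserves irreducibility of characters over `l`. -/
lemma IsIrrChar.induce_of_homogeneous {L K S : Subgroup Γ} (hLK : L ≤ K)
    (hn : (L.subgroupOf K).Normal) {l : L →* ℂˣ} (hS : S = stab K l) {θ : S → ℂ}
    (h : IsIrrChar θ) (hθ : Homogeneous l θ) : IsIrrChar (induce θ : K → ℂ) := by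
  have hSK : S ≤ K := hS ▸ stab_le K l
  -- The induced function has norm 1, and by Frobenius reciprocity its inner product with `χ` is `m
  -- ≥ 1`, so it equals `χ`.
  obtain ⟨χ, hχ, m, hm, hχm⟩ := h.exists_charInner_ne_zero (Subgroup.inclusion hSK)
    (Subgroup.inclusion_injective hSK)
  have : χ = induce θ := by
    refine eq_of_charInner (by simp [hχ.charInner_self]) ?_ ?_
    · rw [charInner_induce_self hLK hn l hS h.conj hθ, h.charInner_self, Complex.one_re]
    · rw [charInner_induce_right hSK θ hχ.conj, hχm, Complex.natCast_re]
      exact_mod_cast Nat.one_le_iff_ne_zero.2 hm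
  exact this ▸ hχ

/-- The upward step for (c). Lying over `T'.ψ` makes `χ` homogeneous for `l`, so Clifford theory
applies to its induction to `T.G`. -/
lemma IsDirectVia.isCliffordCorrespondent_induce {T T' : Triple Γ} {L : Subgroup Γ} {l : L →* ℂˣ}
    (h : IsDirectVia T T' l) {χ : T'.G → ℂ} (hχ : IsIrrChar χ) (hover : LiesOver χ T'.ψ) :
    IsIrrChar (induce χ : T.G → ℂ) ∧ LiesOver (induce χ : T.G → ℂ) T.ψ ∧
      IsCliffordCorrespondent l (induce χ : T.G → ℂ) χ := by
  have hLG : L ≤ T.G := h.le.trans T.le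
  have hnN : (L.subgroupOf T.N).Normal := ⟨fun b hb x =>
    conj_mem_of_normal hLG h.normal (T.le x.2) (show (b : Γ) ∈ L from hb)⟩
  have hN := h.clifford.eq_stab
  have hLN' : L ≤ T'.N := hN ▸ le_stab h.le hnN l
  have hN'N : T'.N ≤ T.N := hN ▸ stab_le T.N l
  have hLG' : L ≤ T'.G := hLN'.trans T'.le
  have hG'G : T'.G ≤ T.G := h.G_eq ▸ stab_le T.G l
  have hl : Homogeneous l (linChar l) := homogeneous_linChar le_rfl l fun b => rfl
  have hψ : Homogeneous l T'.ψ :=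
    T'.irr.homogeneous_of_liesOver h.le hnN hN le_rfl hl h.clifford.liesOver
  have hχl : Homogeneous l χ := hχ.homogeneous_of_liesOver hLG h.normal h.G_eq hLN' hψ hover
  have hirr := hχ.induce_of_homogeneous hLG h.normal h.G_eq hχl
  refine ⟨hirr, ⟨T.le, ?_⟩, ⟨h.G_eq, hχ, ⟨hLG', ?_⟩, rfl⟩⟩
  -- As `T.ψ` is induced from `T'.ψ`, Frobenius reciprocity moves the pairing to `T'.N`, where only
  -- the isotypic part `χ` of the induced character counts.
  · rw [← h.clifford.induce_eq, charInner_induce_right hN'N T'.ψ fun x g =>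
      hirr.conj (Subgroup.inclusion T.le x) (Subgroup.inclusion T.le g)]
    have := charInner_restrict_induce hLG h.normal l h.G_eq hχ.conj hχl hLN' T'.le
      (hN'N.trans T.le) hψ
    refine ne_of_eq_of_ne this hover.2
  · have h1 : ∀ b : L, χ (Subgroup.inclusion hLG' b) = χ 1 * l b := fun b => by
      have := hχl 1 b
      rwa [one_mul, extendZero_of_mem _ (hLG' b.2), extendZero_of_mem _ T'.G.one_mem] at this
    simp only [charInner_eq_sum, h1, linChar, mul_assoc, ← Finset.mul_sum, sum_linear_mul_star,
      if_true]
    exact mul_ne_zero (inv_ne_zero (card_subgroup_ne_zero L))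
      (mul_ne_zero hχ.apply_one_ne_zero (card_subgroup_ne_zero L))

lemma IsDirectVia.isMonomial_iff {T T' : Triple Γ} {L : Subgroup Γ} {l : L →* ℂˣ}
    (h : IsDirectVia T T' l) {χ : T.G → ℂ} {χ' : T'.G → ℂ} (hχ : IsIrrChar χ)
    (hc : IsCliffordCorrespondent l χ χ') : IsMonomial χ ↔ IsMonomial χ' :=
  hc.isMonomial_iff (h.le.trans T.le) h.normal hχ

lemma IsReduction.isIrrChar_and_isMonomial_iff {T T' : Triple Γ} {χ : T.G → ℂ} {χ' : T'.G → ℂ}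
    (hχ : IsIrrChar χ) (h : IsReduction χ T' χ') :
    IsIrrChar χ' ∧ (IsMonomial χ ↔ IsMonomial χ') := by
  induction h with
  | refl => exact ⟨hχ, Iff.rfl⟩
  | step l _ hd hc ih => exact ⟨hc.irr, ih.2.trans (hd.isMonomial_iff ih.1 hc)⟩

lemma IsLinearReduction.isMonomial {T T' : Triple Γ} (h : IsLinearReduction T T')
    (hT : ∀ χ : T.G → ℂ, IsIrrChar χ → LiesOver χ T.ψ → IsMonomial χ) :
    ∀ χ : T'.G → ℂ, IsIrrChar χ → LiesOver χ T'.ψ → IsMonomial χ := by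
  induction h with
  | refl => exact hT
  | tail _ hd ih =>
    obtain ⟨L, l, hd⟩ := hd
    intro χ hχ hover
    obtain ⟨h1, h2, h3⟩ := hd.isCliffordCorrespondent_induce hχ hover
    exact (hd.isMonomial_iff h1 h3).1 (ih _ h1 h2)

end Limits
end LinearLimit
end

theorem propositionl4 {Γ : Type*} [Group Γ] [Finite Γ] :
    -- Clifford correspondence over a linear character of a normal subgroup
    (∀ (G B : Subgroup Γ) (γ : B →* ℂˣ) (χ : G → ℂ) (χγ : stab G γ → ℂ),
      B ≤ G → (B.subgroupOf G).Normal → IsIrrChar χ → LiesOver χ (linChar γ) →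
      IsCliffordCorrespondent γ χ χγ → (IsMonomial χ ↔ IsMonomial χγ)) ∧
    -- linear limits
    (∀ T T' : Triple Γ, IsLinearLimit T T' →
      (∀ (χ : T.G → ℂ) (χ' : T'.G → ℂ), IsIrrChar χ → LiesOver χ T.ψ →
        IsReduction χ T' χ' → (IsMonomial χ ↔ IsMonomial χ')) ∧
      (IsMonomialGroup T.G →
        ∀ χ' : T'.G → ℂ, IsIrrChar χ' → LiesOver χ' T'.ψ → IsMonomial χ')) := by
  have := Fintype.ofFinite Γ
  refine ⟨fun G B γ χ χγ hB hn hχ _ hc => hc.isMonomial_iff hB hn hχ, fun T T' h =>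
    ⟨fun χ χ' hχ _ hr => (hr.isIrrChar_and_isMonomial_iff hχ).2, fun hG => ?_⟩⟩
  exact h.1.isMonomial fun χ hχ _ => hG χ hχ
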